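/- Define $D_1=1$ and $D_{k+1}=2D_k+\sqrt{8+8D_k}+3$ for $k\ge 1$. In the $k$-taxi problem, $k$ taxis are located at points of a metric space $(M,d)$, starting from a given initial configuration. Requests arrive one at a time; each is a pair $(s,t)\in M\times M$, a passenger who has to be carried from $s$ to $t$. When a request arrives, the algorithm may first move its empty taxis, at a cost equal to the total distance they travel, so that some taxi that it selects is at $s$; that taxi then carries the passenger to $t$, and this ride is not charged (only empty runs are paid for). A deterministic online algorithm chooses its reaction to each request as a function of the metric space, the initial configuration and the requests received so far. It is $\rho$-competitive if for every metric space and every initial configuration there is a constant $c$ such that, for every finite request sequence $\sigma$, its cost on $\sigma$ is at most $\rho\cdot\mathrm{OPT}(\sigma)+c$, where $\mathrm{OPT}(\sigma)$ is the infimum of the costs of serving $\sigma$ offline; its competitive ratio is the infimum of all $\rho\in\mathbb{R}$ for which it is $\rho$-competitive ($+\infty$ if there are none). Then, for every integer $k\ge 1$, every deterministic online algorithm for the $k$-taxi problem has competitive ratio at least $D_k$. -/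

import Mathlib

/-- The sequence `D₁ = 1`, `D_{k+1} = 2 D_k + √(8 + 8 D_k) + 3`, for `k ≥ 1`.
The value at index `0` is a placeholder. -/
noncomputable def seqD : ℕ → ℝ
  | 0 => 0
  | 1 => 1
  | n + 2 => 2 * seqD (n + 1) + Real.sqrt (8 + 8 * seqD (n + 1)) + 3

/-- A request of the `k`-taxi problem: the passenger's starting point and destination. -/
structure TaxiRequest (M : Type) where
  start : M
  dest : M

/-- A reaction to a request: the positions to which the (empty) taxis are driven, and the taxi
that then carries the passenger. All taxis may be moved, not only the one that serves. -/
structure TaxiMove (k : ℕ) (M : Type) where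
  pos : Fin k → M
  taxi : Fin k

/-- The selected taxi has been driven to the passenger's starting point. -/
def TaxiMove.Serves {k : ℕ} {M : Type} (a : TaxiMove k M) (r : TaxiRequest M) : Prop :=
  a.pos a.taxi = r.start

/-- The configuration after the selected taxi has carried the passenger to the destination. -/
def TaxiMove.result {k : ℕ} {M : Type} (a : TaxiMove k M) (r : TaxiRequest M) : Fin k → M :=
  Function.update a.pos a.taxi r.dest

/-- The cost of a reaction in configuration `C`: the total length of the empty runs.
Driving the passenger is not charged. -/
noncomputable def TaxiMove.cost {k : ℕ} {M : Type} [MetricSpace M] (C : Fin k → M)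
    (a : TaxiMove k M) : ℝ :=
  ∑ i, dist (C i) (a.pos i)

/-- The total cost of a sequence of requests with the reactions to them, from configuration `C`. -/
noncomputable def taxiScheduleCost {k : ℕ} {M : Type} [MetricSpace M] :
    (Fin k → M) → List (TaxiRequest M × TaxiMove k M) → ℝ
  | _, [] => 0
  | C, (r, a) :: l => a.cost C + taxiScheduleCost (a.result r) l

/-- `s` is a way to serve the request sequence `σ` (possibly with knowledge of all of `σ`). -/
def IsTaxiSchedule {k : ℕ} {M : Type} (σ : List (TaxiRequest M))
    (s : List (TaxiRequest M × TaxiMove k M)) : Prop :=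
  s.map Prod.fst = σ ∧ ∀ p ∈ s, p.2.Serves p.1

/-- The optimal offline cost of `σ` from the initial configuration `C₀`. -/
noncomputable def taxiOpt {k : ℕ} {M : Type} [MetricSpace M] (C₀ : Fin k → M)
    (σ : List (TaxiRequest M)) : ℝ :=
  sInf {x : ℝ | ∃ s : List (TaxiRequest M × TaxiMove k M),
    IsTaxiSchedule σ s ∧ taxiScheduleCost C₀ s = x}

/-- A deterministic online algorithm for the `k`-taxi problem. It is told the metric space and the
initial configuration; its reaction to a request is a function of these, of the list of all
earlier requests and of the current request. -/
structure OnlineTaxiAlgorithm (k : ℕ) where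
  act : ∀ (M : Type) [MetricSpace M], (Fin k → M) → List (TaxiRequest M) → TaxiRequest M →
    TaxiMove k M
  serves : ∀ (M : Type) [MetricSpace M] (C₀ : Fin k → M) (past : List (TaxiRequest M))
    (r : TaxiRequest M), (act M C₀ past r).Serves r

/-- The reactions of the online rule `act` to the requests that arrive after those in `past`. -/
def taxiRun {k : ℕ} {M : Type} (act : List (TaxiRequest M) → TaxiRequest M → TaxiMove k M) :
    List (TaxiRequest M) → List (TaxiRequest M) → List (TaxiRequest M × TaxiMove k M)
  | _, [] => []
  | past, r :: σ => (r, act past r) :: taxiRun act (past ++ [r]) σ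

/-- The cost of the online algorithm `A` on the request sequence `σ`. -/
noncomputable def OnlineTaxiAlgorithm.cost {k : ℕ} (A : OnlineTaxiAlgorithm k) {M : Type}
    [MetricSpace M] (C₀ : Fin k → M) (σ : List (TaxiRequest M)) : ℝ :=
  taxiScheduleCost C₀ (taxiRun (A.act M C₀) [] σ)

/-- `A` is `ρ`-competitive: in every metric space and from every initial configuration, its cost
is at most `ρ` times the optimum, up to an additive constant that does not depend on the
request sequence. -/
def OnlineTaxiAlgorithm.IsCompetitive {k : ℕ} (A : OnlineTaxiAlgorithm k) (ρ : ℝ) : Prop :=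
  ∀ (M : Type) [MetricSpace M] (C₀ : Fin k → M),
    ∃ c : ℝ, ∀ σ : List (TaxiRequest M), A.cost C₀ σ ≤ ρ * taxiOpt C₀ σ + c

/-- The competitive ratio of `A`: the infimum of all `ρ` for which `A` is `ρ`-competitive
(`⊤` if there is none). -/
noncomputable def OnlineTaxiAlgorithm.competitiveRatio {k : ℕ} (A : OnlineTaxiAlgorithm k) :
    EReal :=
  sInf ((fun ρ : ℝ => (ρ : EReal)) '' {ρ : ℝ | A.IsCompetitive ρ})

/-! Requests simulate a chasing game. The online taxis may be pictured as standing on all `k`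
leaves, whereas an offline player ending at leaf `w` has its `w`-taxi at the current leaf instead;
`val w` bounds its cost. Requesting the current leaf twice with the same destination then costs the
algorithm a distance, while every offline player with `w ≠ cur` rides for free
(`isArena_realizable`). Relocating any other leaf onto a second one is free for both sides.

The game bound is by induction on the number of leaves starting at one point (`Forces.succ`). Split
them into the player's branch with `m` leaves, at depth `α`, and a single leaf at depth `β`. The
`m`-leaf strategy, of ratio `d` close to `D`, makes the player's branch grow. If the player has paid
enough, its branch is given up: it must cross `α + β`, and all leaves meet at depth `β` with ratio
`D'`. Otherwise it changes branches early, at depth `α'`, and the roles are exchanged. Writing the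
payment as `d * α + (d - 1) * β + Y`, a change gives `Y' = Y + 2 * α'`, and changing before losing
forces `(d + 1) * α' + Y ≤ (D' - d) * β`, up to small errors.

For `z = Y / β ≥ 0` this means `z' ≥ 2 + z * (d + 1) / (D' - d - z)`. A fixed point would be a root
of `z ^ 2 - (D' - 2 * D + 1) * z + 2 * (D' - D)` in the limit `d = D`. For `D' = 2 * D + 3 + t` its
discriminant is `t ^ 2 - (8 + 8 * D)`, negative for `0 ≤ t < √(8 + 8 * D)`: this is the recursion
for `seqD`. Without a fixed point `z` grows by a fixed amount per turn, and the player loses after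
boundedly many turns. -/

/-- A state of the abstract chasing game played by the adversary: the current positions of the `k`
leaves, the leaf chased by the online player, an upper bound on the offline cost of ending at each
leaf, and a lower bound on the online cost. -/
structure ChaseState (k : ℕ) (M : Type) where
  pos : Fin k → M
  cur : Fin k
  val : Fin k → ℝ
  cost : ℝ

/-- The state after the adversary moves the player's leaf to `x`, if the player then goes to leaf
`u` at cost `δ`. -/
noncomputable def ChaseState.extend {k : ℕ} {M : Type} [MetricSpace M] (s : ChaseState k M)
    (x : M) (u : Fin k) (δ : ℝ) : ChaseState k M :=
  ⟨Function.update s.pos s.cur x, u,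
    Function.update s.val s.cur (s.val s.cur + dist (s.pos s.cur) x), s.cost + δ⟩

/-- The state after leaf `j` has been replaced by a copy of leaf `w`. -/
def ChaseState.branch {k : ℕ} {M : Type} (s : ChaseState k M) (j w : Fin k) : ChaseState k M :=
  ⟨Function.update s.pos j (s.pos w), s.cur, Function.update s.val j (s.val w), s.cost⟩

/-- A set of states in which the adversary can play on, against a fixed online player. -/
structure IsArena {k : ℕ} {M : Type} [MetricSpace M] (T : Set (ChaseState k M)) : Prop where
  extend : ∀ s ∈ T, ∀ x, s.extend x s.cur (dist (s.pos s.cur) x) ∈ T ∨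
    ∃ u, u ≠ s.cur ∧ s.extend x u (dist (s.pos s.cur) (s.pos u)) ∈ T
  branch : ∀ s ∈ T, ∀ j w, j ≠ s.cur → w ≠ j → s.branch j w ∈ T

/-- Every point can be extended by any length in a direction pointing away from finitely many
given points. -/
def HasExtensions (M : Type) [MetricSpace M] : Prop :=
  ∀ (F : Finset M) (p : M) (t : ℝ), 0 ≤ t → ∃ q, ∀ x ∈ F, dist q x = dist p x + t

/-! ### Forcing the player off a leaf or a whole branch -/

section Game

variable {k : ℕ} {M : Type} [MetricSpace M] {T : Set (ChaseState k M)}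

theorem HasExtensions.exists_leaf (hM : HasExtensions M) (L : Fin k → M) (p : M) {t : ℝ}
    (ht : 0 ≤ t) : ∃ q, dist p q = t ∧ ∀ i, dist q (L i) = dist p (L i) + t := by
  classical
  obtain ⟨q, hq⟩ := hM (insert p (Finset.univ.image L)) p t ht
  refine ⟨q, ?_, fun i => hq _ (by simp)⟩
  have := hq p (by simp)
  rw [dist_comm, this, dist_self, zero_add]

/-- Several leaves can be replaced by copies of the same leaf. -/
theorem IsArena.branch_finset (hT : IsArena T) (Z : Finset (Fin k)) (w : Fin k) (hw : w ∉ Z) :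
    ∀ s ∈ T, s.cur ∉ Z → ∃ s' ∈ T, s'.cur = s.cur ∧ s'.cost = s.cost ∧
      (∀ i ∈ Z, s'.pos i = s.pos w ∧ s'.val i = s.val w) ∧
      (∀ i ∉ Z, s'.pos i = s.pos i ∧ s'.val i = s.val i) := by
  classical
  induction Z using Finset.induction_on with
  | empty => exact fun s hs _ => ⟨s, hs, rfl, rfl, by simp, by simp⟩
  | insert j Z hj ih =>
    intro s hs hc
    simp only [Finset.mem_insert, not_or] at hw hc
    obtain ⟨s', hs', h1, h2, h3, h4⟩ := ih hw.2 s hs hc.2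
    refine ⟨s'.branch j w, hT.branch s' hs' j w (by rw [h1]; exact fun h => hc.1 h.symm) hw.1,
      h1, h2, ?_, ?_⟩
    · intro i hi
      by_cases hij : i = j
      · subst hij
        simpa [ChaseState.branch] using h4 w hw.2
      · have : i ∈ Z := by simpa [hij] using hi
        simpa [ChaseState.branch, hij] using h3 i this
    · intro i hi
      simp only [Finset.mem_insert, not_or] at hi
      simpa [ChaseState.branch, hi.1] using h4 i hi.2

/-- If the online cost is bounded in terms of the offline cost, then the adversary can force the
player to leave the present leaf. -/
theorem IsArena.exists_leave (hT : IsArena T) (hM : HasExtensions M) {ρ c₀ : ℝ}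
    (hb : ∀ s ∈ T, ∀ w, s.cost ≤ ρ * s.val w + c₀) {s : ChaseState k M} (hs : s ∈ T)
    {w : Fin k} (hw : w ≠ s.cur) :
    ∃ s' ∈ T, s'.cur ≠ s.cur ∧ (∀ i, i ≠ s.cur → s'.pos i = s.pos i ∧ s'.val i = s.val i) ∧
      s.cost + dist (s.pos s.cur) (s.pos s'.cur) ≤ s'.cost := by
  -- Only the player's leaf moves, so the value at `w` is frozen while each unit extension that the
  -- player follows costs it 1; `n` exceeds the slack left in `hb`.
  have key : ∀ n : ℕ, ∀ t ∈ T, t.cur = s.cur →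
      (∀ i, i ≠ s.cur → t.pos i = s.pos i ∧ t.val i = s.val i) →
      s.cost + dist (s.pos s.cur) (t.pos s.cur) ≤ t.cost → ρ * s.val w + c₀ < t.cost + n →
      ∃ s' ∈ T, s'.cur ≠ s.cur ∧ (∀ i, i ≠ s.cur → s'.pos i = s.pos i ∧ s'.val i = s.val i) ∧
        s.cost + dist (s.pos s.cur) (s.pos s'.cur) ≤ s'.cost := by
    intro n
    induction n with
    | zero =>
      intro t ht _ h2 _ h4
      have := hb t ht w
      rw [(h2 w hw).2] at this
      simp at h4
      linarith
    | succ n ih =>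
      intro t ht h1 h2 h3 h4
      obtain ⟨x, hx, -⟩ := hM.exists_leaf t.pos (t.pos s.cur) zero_le_one
      have htri := dist_triangle (s.pos s.cur) (t.pos s.cur) x
      rcases hT.extend t ht x with h | ⟨u, hu, h⟩
      · refine ih _ h h1 ?_ ?_ ?_
        · intro i hi
          simpa [ChaseState.extend, h1, hi] using h2 i hi
        · simp only [ChaseState.extend, h1, Function.update_self]
          linarith
        · simp only [ChaseState.extend, h1]
          push_cast at h4
          linarith
      · rw [h1] at hu
        refine ⟨_, h, hu, ?_, ?_⟩
        · intro i hi
          simpa [ChaseState.extend, h1, hi] using h2 i hi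
        · simp only [ChaseState.extend, h1, (h2 u hu).1]
          have := dist_triangle (s.pos s.cur) (t.pos s.cur) (s.pos u)
          linarith
  obtain ⟨n, hn⟩ := exists_nat_gt (ρ * s.val w + c₀ - s.cost)
  exact key n s hs rfl (fun i _ => ⟨rfl, rfl⟩) (by simp) (by linarith)

/-- The adversary can give up a whole branch in favour of another leaf `b`. -/
theorem IsArena.collapse (hT : IsArena T) (hM : HasExtensions M) {ρ c₀ : ℝ}
    (hb : ∀ s ∈ T, ∀ w, s.cost ≤ ρ * s.val w + c₀) (q : M) (b : Fin k) :
    ∀ (X : Finset (Fin k)), ∀ s ∈ T, s.cur ∈ X → b ∉ X → (∀ i ∈ X, s.pos i = q) →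
      ∃ s' ∈ T, (∀ i ∈ X, s'.pos i = s.pos b ∧ s'.val i = s.val b) ∧
        (∀ i ∉ X, s'.pos i = s.pos i ∧ s'.val i = s.val i) ∧
        s.cost + dist q (s'.pos s'.cur) ≤ s'.cost := by
  classical
  intro X
  induction X using Finset.strongInduction with
  | H X ih =>
    intro s hs hcur hbX hq
    have hbc : b ≠ s.cur := fun h => hbX (h ▸ hcur)
    obtain ⟨t, ht, h1, h2, h3⟩ := hT.exists_leave hM hb hs hbc
    rw [hq _ hcur] at h3
    -- A hop inside `X` is only credited with a nonnegative cost: the abandoned leaf joins `b` and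
    -- `X` shrinks. The remaining leaves are still at `q`, so the hop that leaves `X` is charged in
    -- full from `q`.
    by_cases htX : t.cur ∈ X
    · obtain ⟨r, hr, r1, r2, r3, r4⟩ :=
        hT.branch_finset {s.cur} b (by simpa using hbc) t ht (by simpa using h1)
      have hrX : r.cur ∈ X.erase s.cur := by simp [r1, h1, htX]
      obtain ⟨s', hs', a1, a2, a3⟩ := ih (X.erase s.cur) (Finset.erase_ssubset hcur) r hr hrX
        (by simp [hbX]) (by
          intro i hi
          simp only [Finset.mem_erase] at hi
          rw [(r4 i (by simpa using hi.1)).1, (h2 i hi.1).1, hq i hi.2])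
      have hrb : r.pos b = s.pos b ∧ r.val b = s.val b := by
        rw [(r4 b (by simpa using hbc)).1, (r4 b (by simpa using hbc)).2]
        exact h2 b hbc
      refine ⟨s', hs', ?_, ?_, ?_⟩
      · intro i hi
        by_cases hic : i = s.cur
        · subst hic
          obtain ⟨e1, e2⟩ := a2 s.cur (by simp)
          obtain ⟨e3, e4⟩ := r3 s.cur (by simp)
          rw [e1, e2, e3, e4]
          exact h2 b hbc
        · have := a1 i (by simp [hic, hi])
          rwa [hrb.1, hrb.2] at this
      · intro i hi
        have hic : i ≠ s.cur := fun h => hi (h ▸ hcur)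
        obtain ⟨e1, e2⟩ := a2 i (by simp [hi])
        obtain ⟨e3, e4⟩ := r4 i (by simpa using hic)
        rw [e1, e2, e3, e4]
        exact h2 i hic
      · have : 0 ≤ dist q (s.pos t.cur) := dist_nonneg
        linarith
    · obtain ⟨r, hr, r1, r2, r3, r4⟩ := hT.branch_finset X b hbX t ht htX
      refine ⟨r, hr, ?_, ?_, ?_⟩
      · intro i hi
        rw [(r3 i hi).1, (r3 i hi).2]
        exact h2 b hbc
      · intro i hi
        rw [(r4 i hi).1, (r4 i hi).2]
        exact h2 i fun h => hi (h ▸ hcur)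
      · rw [r2, r1, (r4 _ htX).1, (h2 _ h1).1]
        exact h3

end Game

/-! ### Two branches: finishing, and changing sides -/

section Branches

variable {k : ℕ} {M : Type} [MetricSpace M]

/-- From `s`, whose leaves in `S` are gathered at `p` with value `w`, the adversary reaches a state
whose leaves in `S` are gathered again, further away by `ω`, and either the player has paid at
least `d * ω` (and at least `η`), or the player has left `S`, paying the distance up to `e`. -/
def Progress (T : Set (ChaseState k M)) (s : ChaseState k M) (S : Finset (Fin k)) (p : M)
    (w d e η : ℝ) : Prop :=
  ∃ s' ∈ T, ∃ (q : M) (ω : ℝ), 0 ≤ ω ∧ ω ≤ e ∧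
    (∀ i ∉ S, s'.pos i = s.pos i ∧ s'.val i = s.val i) ∧
    (∀ i ∈ S, s'.pos i = q ∧ s'.val i = w + ω) ∧
    (∀ i ∉ S, dist q (s.pos i) = dist p (s.pos i) + ω) ∧
    ((s'.cur ∈ S ∧ s.cost + d * ω ≤ s'.cost ∧ s.cost + η ≤ s'.cost) ∨
      (s'.cur ∉ S ∧ s.cost + dist q (s.pos s'.cur) - e ≤ s'.cost))

/-- With `m` leaves at a common position, the adversary can force every ratio below `D`. -/
def Forces (T : Set (ChaseState k M)) (m : ℕ) (D : ℝ) : Prop :=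
  ∀ d < D, ∀ e > 0, ∃ η > 0, ∀ s ∈ T, ∀ (S : Finset (Fin k)) (p : M) (w : ℝ), S.card = m →
    s.cur ∈ S → (∀ i ∈ S, s.pos i = p ∧ s.val i = w) → Progress T s S p w d e η

/-- The leaves of `S` form two branches growing out of `p`: the leaves in `X`, the player's among
them, are at depth `α`, the leaf `b` is at depth `β`. Since the state `s₀` the player has paid
`d * α + (d - 1) * β + Y`. -/
structure TwoBranch (T : Set (ChaseState k M)) (s₀ : ChaseState k M) (S : Finset (Fin k)) (p : M)
    (w d σ : ℝ) (s : ChaseState k M) (X : Finset (Fin k)) (b : Fin k) (α β Y : ℝ) : Prop where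
  mem : s ∈ T
  cur_mem : s.cur ∈ X
  notMem : b ∉ X
  insert_eq : insert b X = S
  left : ∀ i ∈ X, s.pos i = s.pos s.cur ∧ s.val i = w + α
  right : s.val b = w + β
  out : ∀ i ∉ S, s.pos i = s₀.pos i ∧ s.val i = s₀.val i
  dist_left : ∀ i ∉ S, dist (s.pos s.cur) (s₀.pos i) = dist p (s₀.pos i) + α
  dist_right : ∀ i ∉ S, dist (s.pos b) (s₀.pos i) = dist p (s₀.pos i) + β
  dist_branch : dist (s.pos s.cur) (s.pos b) = α + β
  left_nonneg : 0 ≤ α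
  right_nonneg : 0 ≤ β
  scale : σ ≤ α + β
  start_le : s₀.cost ≤ s.cost
  le_cost : s₀.cost + d * α + (d - 1) * β + Y ≤ s.cost

variable {T : Set (ChaseState k M)} {s₀ s : ChaseState k M} {S X : Finset (Fin k)} {p : M}
  {w d d' σ α β Y e η err : ℝ} {b : Fin k} {m : ℕ}

theorem TwoBranch.mono (h : TwoBranch T s₀ S p w d σ s X b α β Y) {Y' : ℝ} (hY : Y' ≤ Y) :
    TwoBranch T s₀ S p w d σ s X b α β Y' :=
  { h with le_cost := by linarith [h.le_cost] }

/-- If the player has paid enough, the adversary gives up the player's branch. -/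
theorem TwoBranch.finish (h : TwoBranch T s₀ S p w d σ s X b α β Y) (hT : IsArena T)
    (hM : HasExtensions M) {ρ c₀ : ℝ} (hb : ∀ s ∈ T, ∀ w, s.cost ≤ ρ * s.val w + c₀)
    (hβ : β ≤ err) (hc : s₀.cost + d' * β ≤ s.cost + α + β) :
    Progress T s₀ S p w d' err σ := by
  obtain ⟨s', hs', h1, h2, h3⟩ := hT.collapse hM hb (s.pos s.cur) b X s h.mem h.cur_mem h.notMem
    fun i hi => (h.left i hi).1
  have hS : ∀ i ∈ S, s'.pos i = s.pos b ∧ s'.val i = w + β := by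
    intro i hi
    rw [← h.insert_eq, Finset.mem_insert] at hi
    rcases hi with rfl | hi
    · rw [(h2 i h.notMem).1, (h2 i h.notMem).2, h.right]
      exact ⟨rfl, rfl⟩
    · rw [(h1 i hi).1, (h1 i hi).2, h.right]
      exact ⟨rfl, rfl⟩
  have hX : ∀ i ∉ S, i ∉ X := fun i hi hx =>
    hi (by rw [← h.insert_eq]; exact Finset.mem_insert_of_mem hx)
  have hout : ∀ i ∉ S, s'.pos i = s₀.pos i ∧ s'.val i = s₀.val i := by
    intro i hi
    rw [(h2 i (hX i hi)).1, (h2 i (hX i hi)).2]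
    exact h.out i hi
  refine ⟨s', hs', s.pos b, β, h.right_nonneg, hβ, hout, hS, h.dist_right, ?_⟩
  -- If the player escapes from `S`, it has paid for a path from depth `α` rather than `β`; the
  -- tolerance absorbs this because `β ≤ err`.
  by_cases hcur : s'.cur ∈ S
  · left
    rw [(hS _ hcur).1, h.dist_branch] at h3
    have := h.scale
    have := h.start_le
    exact ⟨hcur, by linarith, by linarith⟩
  · right
    rw [(hout _ hcur).1, h.dist_left _ hcur] at h3
    rw [h.dist_right _ hcur]
    have := h.left_nonneg
    have := h.start_le
    exact ⟨hcur, by linarith⟩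

/-- The adversary plays in the player's branch until the player goes to the other one, and then
exchanges the roles of the branches. -/
theorem TwoBranch.turn (h : TwoBranch T s₀ S p w d σ s X b α β Y) (hT : IsArena T)
    (hM : HasExtensions M) {ρ c₀ : ℝ} (hb : ∀ s ∈ T, ∀ w, s.cost ≤ ρ * s.val w + c₀)
    (hd : 0 ≤ d) (hη : 0 < η)
    (hsub : ∀ s ∈ T, ∀ (S : Finset (Fin k)) (p : M) (w : ℝ), S.card = m →
      s.cur ∈ S → (∀ i ∈ S, s.pos i = p ∧ s.val i = w) → Progress T s S p w d e η)
    (hS : S.card = m + 1) (heσ : e ≤ σ) (he : e ≤ err) (hβ : β ≤ err)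
    (hα : ∀ a, (d + 1) * a + Y ≤ (d' - d) * β + (d + 1) * e → a ≤ err) :
    Progress T s₀ S p w d' err σ ∨ ∃ s' X' b' α', TwoBranch T s₀ S p w d σ s' X' b' β α'
      (Y + 2 * α' - (d + 1) * e) ∧ α ≤ α' ∧ (d + 1) * α' + Y ≤ (d' - d) * β + (d + 1) * e := by
  -- `n * η` exceeds what the player may still pay before `finish` applies. Counting payments rather
  -- than depth is necessary, since a round may have `ω = 0`.
  have key : ∀ n : ℕ, ∀ (s : ChaseState k M) (a : ℝ), TwoBranch T s₀ S p w d σ s X b a β Y →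
      α ≤ a → s₀.cost + d' * β < s.cost + n * η →
      Progress T s₀ S p w d' err σ ∨ ∃ s' X' b' α', TwoBranch T s₀ S p w d σ s' X' b' β α'
        (Y + 2 * α' - (d + 1) * e) ∧ α ≤ α' ∧
        (d + 1) * α' + Y ≤ (d' - d) * β + (d + 1) * e := by
    intro n
    induction n with
    | zero =>
      intro s a h _ hc
      refine Or.inl (h.finish hT hM hb hβ ?_)
      have := h.left_nonneg
      have := h.right_nonneg
      simp only [Nat.cast_zero, zero_mul, add_zero] at hc
      linarith
    | succ n ih =>
      intro s a h ha hc
      by_cases hfin : s₀.cost + d' * β ≤ s.cost + a + β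
      · exact Or.inl (h.finish hT hM hb hβ hfin)
      push Not at hfin
      have hcardX : X.card = m := by
        have := hS
        rw [← h.insert_eq, Finset.card_insert_of_notMem h.notMem] at this
        omega
      obtain ⟨t, ht, q, ω, hω, hωe, hto, hti, htd, hcase⟩ :=
        hsub s h.mem X (s.pos s.cur) (w + a) hcardX h.cur_mem h.left
      have ha0 := h.left_nonneg
      have hβ0 := h.right_nonneg
      have hcost := h.le_cost
      have hXS : ∀ i ∉ S, i ∉ X := fun i hi hx =>
        hi (by rw [← h.insert_eq]; exact Finset.mem_insert_of_mem hx)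
      have hbS : b ∈ S := by rw [← h.insert_eq]; exact Finset.mem_insert_self _ _
      have hcS : s.cur ∈ S := by
        rw [← h.insert_eq]; exact Finset.mem_insert_of_mem h.cur_mem
      have hcb : s.cur ≠ b := fun hh => h.notMem (hh ▸ h.cur_mem)
      have hqb : dist q (s.pos b) = a + ω + β := by
        rw [htd b h.notMem, h.dist_branch]; ring
      have hqo : ∀ i ∉ S, dist q (s₀.pos i) = dist p (s₀.pos i) + (a + ω) := by
        intro i hi
        rw [← (h.out i hi).1, htd i (hXS i hi), (h.out i hi).1, h.dist_left i hi]; ring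
      have hto' : ∀ i ∉ S, t.pos i = s₀.pos i ∧ t.val i = s₀.val i := by
        intro i hi
        rw [(hto i (hXS i hi)).1, (hto i (hXS i hi)).2]
        exact h.out i hi
      have hde : d * ω ≤ d * e := mul_le_mul_of_nonneg_left hωe hd
      -- Being unable to finish at depth `a` gives this bound for `a`; the last round adds at most
      -- `e` to the depth.
      have hbound : (d + 1) * (a + ω) + Y ≤ (d' - d) * β + (d + 1) * e := by nlinarith
      rcases hcase with ⟨hcur, h1, h2⟩ | ⟨hcur, h1⟩
      · have e1 := (hti _ hcur).1
        have e2 := hto b h.notMem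
        refine ih t (a + ω) ⟨ht, hcur, h.notMem, h.insert_eq, ?_, ?_, hto', ?_, ?_, ?_, by linarith,
          hβ0, by linarith [h.scale], by linarith [h.start_le], by linarith⟩ (by linarith) ?_
        · intro i hi
          rw [e1, (hti i hi).1, (hti i hi).2]
          exact ⟨rfl, by ring⟩
        · rw [e2.2, h.right]
        · rw [e1]; exact hqo
        · rw [e2.1]; exact h.dist_right
        · rw [e1, e2.1, hqb]
        · push_cast at hc
          linarith
      · by_cases hcb' : t.cur = b
        · right
          -- One leaf keeps the old branch alive and the others join `b`, so the player again has
          -- `m` leaves around it.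
          obtain ⟨r, hr, r1, r2, r3, r4⟩ := hT.branch_finset (X.erase s.cur) b (by simp [h.notMem])
            t ht (by simp [hcb', h.notMem])
          have rb := r4 b (by simp [h.notMem])
          have rc := r4 s.cur (by simp)
          rw [(hti _ h.cur_mem).1, (hti _ h.cur_mem).2] at rc
          rw [(hto _ h.notMem).1, (hto _ h.notMem).2] at rb
          rw [(hto _ h.notMem).1, (hto _ h.notMem).2] at r3
          rw [hcb', hqb] at h1
          refine ⟨r, insert b (X.erase s.cur), s.cur, a + ω, ⟨hr, ?_, ?_, ?_, ?_, ?_, ?_, ?_, ?_, ?_,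
            hβ0, by linarith, by linarith [h.scale], by linarith [h.start_le, h.scale], ?_⟩,
            by linarith, hbound⟩
          · simp [r1, hcb']
          · simp [hcb]
          · rw [Finset.insert_comm, Finset.insert_erase h.cur_mem, h.insert_eq]
          · intro i hi
            rw [r1, hcb', rb.1]
            rcases Finset.mem_insert.1 hi with rfl | hi
            · exact ⟨rb.1, by rw [rb.2, h.right]⟩
            · exact ⟨(r3 i hi).1, by rw [(r3 i hi).2, h.right]⟩
          · rw [rc.2]; ring
          · intro i hi
            have hi' : i ∉ X.erase s.cur := fun hh => hXS i hi (Finset.mem_of_mem_erase hh)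
            rw [(r4 i hi').1, (r4 i hi').2]
            exact hto' i hi
          · rw [r1, hcb', rb.1]; exact h.dist_right
          · rw [rc.1]; exact hqo
          · rw [r1, hcb', rb.1, rc.1, dist_comm, hqb]; ring
          · rw [r2]
            linarith
        · have hcS' : t.cur ∉ S := by
            rw [← h.insert_eq]
            simp [hcb', hcur]
          left
          obtain ⟨r, hr, r1, r2, r3, r4⟩ := hT.branch_finset {b} s.cur (by simpa using hcb)
            t ht (by simpa using hcb')
          rw [(hti _ h.cur_mem).1, (hti _ h.cur_mem).2] at r3
          refine ⟨r, hr, q, a + ω, by linarith, hα _ hbound, ?_, ?_, hqo, Or.inr ⟨by rwa [r1], ?_⟩⟩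
          · intro i hi
            have : i ≠ b := fun hh => hi (hh ▸ hbS)
            rw [(r4 i (by simpa using this)).1, (r4 i (by simpa using this)).2]
            exact hto' i hi
          · intro i hi
            rw [← h.insert_eq] at hi
            by_cases hib : i = b
            · rw [(r3 i (by simpa using hib)).1, (r3 i (by simpa using hib)).2]
              exact ⟨rfl, by ring⟩
            · rw [(r4 i (by simpa using hib)).1, (r4 i (by simpa using hib)).2]
              have hiX : i ∈ X := by simpa [hib] using hi
              rw [(hti i hiX).1, (hti i hiX).2]
              exact ⟨rfl, by ring⟩
          · rw [r1, r2, ← (h.out _ hcS').1]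
            linarith [h.start_le]
  obtain ⟨n, hn⟩ := exists_nat_gt ((s₀.cost + d' * β - s.cost) / η)
  refine key n s α h le_rfl ?_
  rw [div_lt_iff₀ hη] at hn
  linarith

/-- A single leaf is moved straight away from all others. -/
theorem forces_one (hT : IsArena T) (hM : HasExtensions M) : Forces T 1 1 := by
  intro d hd e he
  refine ⟨e, he, ?_⟩
  intro s hs S p w hS hcur hgat
  obtain ⟨a, rfl⟩ := Finset.card_eq_one.1 hS
  have hcur' : s.cur = a := by simpa using hcur
  subst hcur'
  obtain ⟨hp, hw⟩ := hgat _ hcur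
  obtain ⟨x, hx, hx'⟩ := hM.exists_leaf s.pos (s.pos s.cur) he.le
  have hcommon : ∀ u δ, (∀ i ∉ ({s.cur} : Finset (Fin k)),
      (s.extend x u δ).pos i = s.pos i ∧ (s.extend x u δ).val i = s.val i) ∧
      (∀ i ∈ ({s.cur} : Finset (Fin k)),
        (s.extend x u δ).pos i = x ∧ (s.extend x u δ).val i = w + e) := by
    intro u δ
    constructor
    · intro i hi
      have hi' : i ≠ s.cur := by simpa using hi
      simp [ChaseState.extend, hi']
    · intro i hi
      have hi' : i = s.cur := by simpa using hi
      subst hi'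
      simp [ChaseState.extend, hx, hw]
  rcases hT.extend s hs x with h | ⟨u, hu, h⟩
  · refine ⟨_, h, x, e, he.le, le_rfl, (hcommon _ _).1, (hcommon _ _).2, ?_, Or.inl ⟨?_, ?_, ?_⟩⟩
    · intro i _
      rw [hx' i, hp]
    · simp [ChaseState.extend]
    · simp only [ChaseState.extend, hx]
      nlinarith
    · simp only [ChaseState.extend, hx, le_refl]
  · refine ⟨_, h, x, e, he.le, le_rfl, (hcommon _ _).1, (hcommon _ _).2, ?_, Or.inr ⟨?_, ?_⟩⟩
    · intro i _
      rw [hx' i, hp]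
    · simpa [ChaseState.extend] using hu
    · simp only [ChaseState.extend, hx' u]
      linarith

end Branches

/-! ### The recursion on real numbers -/

/-- At `θ = 0` the quadratic has minimum `Δ / 4` with `Δ = 8 + 8 * D - t ^ 2 > 0`. A small `θ`, the
room for all approximation errors, costs at most half of it. -/
theorem exists_slack {D d' : ℝ} (hD : 1 ≤ D) (hd' : d' < 2 * D + Real.sqrt (8 + 8 * D) + 3) :
    ∃ D' θ η : ℝ, d' ≤ D' ∧ 2 * D + 3 ≤ D' ∧ 0 < θ ∧ θ ≤ 1 / 2 ∧ 0 < η ∧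
      ∀ z : ℝ, η ≤ z ^ 2 - (D' - 2 * D + 1 + 2 * θ) * z + (2 - θ) * (D' - D + 2 * θ) := by
  set t := max (d' - 2 * D - 3) 0 with ht
  have ht0 : 0 ≤ t := le_max_right _ _
  have htd : d' - 2 * D - 3 ≤ t := le_max_left _ _
  have hs : 0 < Real.sqrt (8 + 8 * D) := Real.sqrt_pos.2 (by linarith)
  have htlt : t < Real.sqrt (8 + 8 * D) := max_lt (by linarith) hs
  have hsq : t ^ 2 < 8 + 8 * D := by
    have := Real.sq_sqrt (show (0 : ℝ) ≤ 8 + 8 * D by linarith)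
    nlinarith
  set Δ := 8 + 8 * D - t ^ 2 with hΔ
  have hΔ0 : 0 < Δ := by linarith
  set N := 8 * t + 4 * D + 40 with hN
  have hN0 : 0 < N := by linarith
  set θ := min (1 / 2) (Δ / (2 * N)) with hθ
  have hθ0 : 0 < θ := lt_min (by norm_num) (by positivity)
  have hθ1 : θ ≤ 1 / 2 := min_le_left _ _
  have hθN : θ * N ≤ Δ / 2 := by
    have : θ ≤ Δ / (2 * N) := min_le_right _ _
    rw [le_div_iff₀ (by positivity)] at this
    linarith
  refine ⟨2 * D + 3 + t, θ, Δ / 8, by linarith, by linarith, hθ0, hθ1, by linarith, ?_⟩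
  intro z
  have h1 := sq_nonneg (z - (t + 4 + 2 * θ) / 2)
  have h2 : θ ^ 2 ≤ θ / 2 := by nlinarith
  nlinarith

/-- The missing fixed point, quantitatively: with `κ = D' - D + 2 * θ`, the bound `hc` on `α` and
the positive quadratic make the ratio of `Y` to the other branch's depth grow by at least `η / κ` in
one turn. -/
theorem ratio_step {D' D θ η z β α Y : ℝ} (hβ : 0 < β) (hα : 0 < α) (hκ : 0 < D' - D + 2 * θ)
    (hd : 0 < D - θ + 1) (hη : 0 < η)
    (hq : ∀ z : ℝ, η ≤ z ^ 2 - (D' - 2 * D + 1 + 2 * θ) * z + (2 - θ) * (D' - D + 2 * θ))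
    (hz : 0 ≤ z) (hY : z * β = Y) (hc : (D - θ + 1) * α + Y ≤ (D' - D + 2 * θ) * β) :
    (z + η / (D' - D + 2 * θ)) * α ≤ Y + (2 - θ) * α := by
  set κ := D' - D + 2 * θ with hκd
  have hlt : z < κ := by
    by_contra hcon
    push Not at hcon
    nlinarith [mul_le_mul_of_nonneg_right hcon hβ.le, mul_pos hd hα]
  have hk : 0 < κ - z := by linarith
  have h1 : (D - θ + 1) * α ≤ (κ - z) * β := by linarith
  have h2 := hq z
  have h3 : η / κ * κ = η := div_mul_cancel₀ _ hκ.ne'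
  have h4 : η / κ * (κ - z) ≤ η := by
    have : 0 ≤ η / κ := by positivity
    nlinarith
  have h5 : (z + η / κ - (2 - θ)) * (κ - z) ≤ z * (D - θ + 1) := by nlinarith
  have h6 : ((z + η / κ - (2 - θ)) * (κ - z)) * α ≤ (z * (κ - z)) * β := by
    calc _ ≤ z * (D - θ + 1) * α := mul_le_mul_of_nonneg_right h5 hα.le
      _ = z * ((D - θ + 1) * α) := by ring
      _ ≤ z * ((κ - z) * β) := mul_le_mul_of_nonneg_left h1 hz
      _ = _ := by ring
  have h7 : (κ - z) * ((z + η / κ - (2 - θ)) * α) ≤ (κ - z) * Y := by rw [← hY]; linarith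
  have := le_of_mul_le_mul_left h7 hk
  linarith

/-- The two-branch search game on real numbers: `G α β Y` says that the player is at depth `α` of
one branch, the other branch has depth `β`, and the player has paid `(D - θ) * (α + β) - β + Y`.
If the adversary wins whenever the player has paid `D' * β` after going to the other branch, then
it wins after a bounded number of turns. -/
theorem two_branch_search {D D' θ η : ℝ} (hD : 1 ≤ D) (hD' : 2 * D + 3 ≤ D') (hθ : 0 < θ)
    (hθ1 : θ ≤ 1 / 2) (hη : 0 < η)
    (hq : ∀ z : ℝ, η ≤ z ^ 2 - (D' - 2 * D + 1 + 2 * θ) * z + (2 - θ) * (D' - D + 2 * θ)) :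
    ∃ B : ℝ, 1 ≤ B ∧ ∀ (σ err : ℝ) (G : ℝ → ℝ → ℝ → Prop) (Win : Prop), 0 < σ → B * σ ≤ err →
      (∀ α β Y, G α β Y → β ≤ err → D' * β ≤ (D - θ + 1) * α + (D - θ) * β + Y → Win) →
      (∀ α β Y, G α β Y → β ≤ err →
        (∀ a, (D - θ + 1) * a + Y ≤ (D' - (D - θ)) * β + θ * (σ / D') → a ≤ err) →
        Win ∨ ∃ α', G β α' (Y + 2 * α' - θ * (σ / D')) ∧ α ≤ α' ∧
          (D - θ + 1) * α' + Y ≤ (D' - (D - θ)) * β + θ * (σ / D')) →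
      G 0 σ (-(D - θ - 1) * σ) → Win := by
  set κ := D' - D + 2 * θ with hκd
  have hκ : 0 < κ := by linarith
  set K := κ + D with hK
  have hK1 : 1 ≤ K := by linarith
  -- `N` turns lift the ratio from 0 to `κ`, where the player has lost; `N₁` turns make a negative
  -- `Y` nonnegative. Each turn, including the first, enlarges the depth bound by at most the factor
  -- `K`.
  obtain ⟨N, hN⟩ := exists_nat_gt (κ / (η / κ))
  rw [div_lt_iff₀ (by positivity)] at hN
  obtain ⟨N₁, hN₁⟩ := exists_nat_gt (D * D')
  refine ⟨K ^ (N₁ + N + 1), one_le_pow₀ hK1, ?_⟩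
  intro σ err G Win hσ hB hfin hturn hG
  set l := σ / D' with hl
  have hD'0 : 0 < D' := by linarith
  have hl0 : 0 < l := by positivity
  have hlσ : l * D' = σ := div_mul_cancel₀ _ hD'0.ne'
  have hlσ' : l ≤ σ := by nlinarith
  have hbound : ∀ β Δ Y : ℝ, l ≤ β → β ≤ Δ → -D * Δ ≤ Y → ∀ a,
      (D - θ + 1) * a + Y ≤ (D' - (D - θ)) * β + θ * l →
      (D - θ + 1) * a + Y ≤ κ * β ∧ a ≤ K * Δ := by
    intro β Δ Y h1 h2 h3 a ha
    have h4 : θ * l ≤ θ * β := mul_le_mul_of_nonneg_left h1 hθ.le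
    have h5 : (D - θ + 1) * a + Y ≤ κ * β := by rw [hκd]; linarith
    refine ⟨h5, ?_⟩
    have h6 : κ * β ≤ κ * Δ := mul_le_mul_of_nonneg_left h2 hκ.le
    have h7 : (D - θ + 1) * a ≤ K * Δ := by rw [hK]; linarith
    by_contra hcon
    push Not at hcon
    have h8 : 0 < K * Δ := mul_pos (by linarith) (by linarith)
    nlinarith
  have hpow : ∀ (n : ℕ) (Δ : ℝ), 0 < Δ → K ^ (n + 1) * Δ ≤ err → K ^ n * (K * Δ) ≤ err ∧
      K * Δ ≤ err ∧ Δ ≤ err := by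
    intro n Δ hΔ h
    have h1 : K ^ n * (K * Δ) ≤ err := by rw [pow_succ] at h; linarith
    have h2 : K * Δ ≤ K ^ n * (K * Δ) :=
      le_mul_of_one_le_left (by positivity) (one_le_pow₀ hK1)
    have h3 : Δ ≤ K * Δ := le_mul_of_one_le_left hΔ.le hK1
    exact ⟨h1, by linarith, by linarith⟩
  have late : ∀ (n : ℕ) (Δ α β Y : ℝ), G α β Y → l ≤ α → l ≤ β → α ≤ Δ → β ≤ Δ →
      K ^ n * Δ ≤ err → 0 ≤ Y → (κ - n * (η / κ)) * β ≤ Y → Win := by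
    intro n
    induction n with
    | zero =>
      intro Δ α β Y hG hα hβ hαΔ hβΔ hΔ _ hY
      simp only [Nat.cast_zero, zero_mul, sub_zero, pow_zero, one_mul] at hY hΔ
      refine hfin α β Y hG (by linarith) ?_
      have : 0 ≤ (D - θ + 1) * α := mul_nonneg (by linarith) (by linarith)
      have : 0 ≤ θ * β := mul_nonneg hθ.le (by linarith)
      rw [hκd] at hY
      linarith
    | succ n ih =>
      intro Δ α β Y hG hα hβ hαΔ hβΔ hΔ hY0 hY
      have hΔ0 : 0 < Δ := by linarith
      obtain ⟨p1, p2, p3⟩ := hpow n Δ hΔ0 hΔ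
      have hYΔ : -D * Δ ≤ Y := by nlinarith
      rcases hturn α β Y hG (by linarith)
        (fun a ha => (hbound β Δ Y hβ hβΔ hYΔ a ha).2.trans p2) with h | ⟨a, hG', ha, hc⟩
      · exact h
      · obtain ⟨b1, b2⟩ := hbound β Δ Y hβ hβΔ hYΔ a hc
        have hβ0 : 0 < β := by linarith
        have hYβ : Y / β * β = Y := div_mul_cancel₀ _ hβ0.ne'
        have hstep := ratio_step hβ0 (show 0 < a by linarith) hκ (by linarith) hη hq
          (show 0 ≤ Y / β by positivity) hYβ b1
        have hz : κ - (n + 1 : ℕ) * (η / κ) ≤ Y / β := by rwa [le_div_iff₀ hβ0]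
        push_cast at hz
        have hz' : (κ - n * (η / κ)) * a ≤ (Y / β + η / κ) * a :=
          mul_le_mul_of_nonneg_right (by linarith) (by linarith)
        have hθl : θ * l ≤ θ * a := mul_le_mul_of_nonneg_left (by linarith) hθ.le
        have hθa : θ * a ≤ 1 / 2 * a := mul_le_mul_of_nonneg_right hθ1 (by linarith)
        refine ih (K * Δ) β a _ hG' hβ (by linarith) ?_ b2 p1 (by linarith) (by linarith)
        exact hβΔ.trans (le_mul_of_one_le_left hΔ0.le hK1)
  -- While `Y` is negative the ratio argument is not available, but each turn adds `2 * a - θ * l ≥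
  -- l` to `Y`.
  have early : ∀ (n : ℕ) (Δ α β Y : ℝ), G α β Y → l ≤ α → l ≤ β → α ≤ Δ → β ≤ Δ →
      K ^ (n + N) * Δ ≤ err → -D * Δ ≤ Y → -n * l ≤ Y → Win := by
    intro n
    induction n with
    | zero =>
      intro Δ α β Y hG hα hβ hαΔ hβΔ hΔ _ hY
      simp only [Nat.cast_zero, neg_zero, zero_mul, zero_add] at hY hΔ
      refine late N Δ α β Y hG hα hβ hαΔ hβΔ hΔ hY ?_
      nlinarith
    | succ n ih =>
      intro Δ α β Y hG hα hβ hαΔ hβΔ hΔ hYΔ hY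
      have hΔ0 : 0 < Δ := by linarith
      rw [add_right_comm] at hΔ
      obtain ⟨p1, p2, p3⟩ := hpow (n + N) Δ hΔ0 hΔ
      rcases hturn α β Y hG (by linarith)
        (fun a ha => (hbound β Δ Y hβ hβΔ hYΔ a ha).2.trans p2) with h | ⟨a, hG', ha, hc⟩
      · exact h
      · obtain ⟨b1, b2⟩ := hbound β Δ Y hβ hβΔ hYΔ a hc
        have hKΔ : Δ ≤ K * Δ := le_mul_of_one_le_left hΔ0.le hK1
        have hθl : θ * l ≤ 1 / 2 * l := mul_le_mul_of_nonneg_right hθ1 hl0.le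
        push_cast at hY
        refine ih (K * Δ) β a _ hG' hβ (by linarith) (by linarith) b2 p1 ?_ (by linarith)
        have : D * Δ ≤ D * (K * Δ) := mul_le_mul_of_nonneg_left hKΔ (by linarith)
        linarith
  obtain ⟨p1, p2, p3⟩ := hpow (N₁ + N) σ hσ hB
  have hθσ : 0 ≤ θ * σ := by positivity
  have hY0 : -D * σ ≤ -(D - θ - 1) * σ := by nlinarith
  have hθl : θ * l ≤ 1 / 2 * l := mul_le_mul_of_nonneg_right hθ1 hl0.le
  rcases hturn 0 σ _ hG p3 (fun a ha => (hbound σ σ _ hlσ' le_rfl hY0 a ha).2.trans p2) with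
    h | ⟨a, hG', ha, hc⟩
  · exact h
  · obtain ⟨b1, b2⟩ := hbound σ σ _ hlσ' le_rfl hY0 a hc
    -- The choice `l = σ / D'` makes a branch of depth at most `l` an immediate win, as `D' * a ≤
    -- σ`. Otherwise both depths stay at least `l` from now on.
    by_cases hal : a ≤ l
    · refine hfin σ a _ hG' (b2.trans p2) ?_
      have h1 : D' * a ≤ D' * l := mul_le_mul_of_nonneg_left hal hD'0.le
      have h2 : 0 ≤ (D - θ) * a := mul_nonneg (by linarith) ha
      linarith
    · push Not at hal
      refine early N₁ (K * σ) σ a _ hG' hlσ' hal.le (le_mul_of_one_le_left hσ.le hK1) b2 p1 ?_ ?_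
      · have : D * σ ≤ D * (K * σ) :=
          mul_le_mul_of_nonneg_left (le_mul_of_one_le_left hσ.le hK1) (by linarith)
        linarith
      · have : D * D' * l ≤ N₁ * l := mul_le_mul_of_nonneg_right hN₁.le hl0.le
        have : D * D' * l = D * σ := by rw [← hlσ]; ring
        linarith

/-! ### The induction on the number of leaves -/

section Step

variable {k : ℕ} {M : Type} [MetricSpace M] {T : Set (ChaseState k M)}

theorem Progress.mono {s : ChaseState k M} {S : Finset (Fin k)} {p : M} {w d d' e η : ℝ}
    (h : Progress T s S p w d e η) (hd : d' ≤ d) : Progress T s S p w d' e η := by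
  obtain ⟨s', hs', q, ω, h1, h2, h3, h4, h5, h6⟩ := h
  refine ⟨s', hs', q, ω, h1, h2, h3, h4, h5, h6.imp_left fun ⟨a, b, c⟩ => ⟨a, ?_, c⟩⟩
  have := mul_le_mul_of_nonneg_right hd h1
  linarith

/-- From a common position of the leaves in `S`, the adversary can split off a branch of length
`σ`, or it makes progress at once. -/
theorem IsArena.split (hT : IsArena T) (hM : HasExtensions M) {ρ c₀ : ℝ}
    (hb : ∀ s ∈ T, ∀ w, s.cost ≤ ρ * s.val w + c₀) {s : ChaseState k M} (hs : s ∈ T)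
    {S : Finset (Fin k)} {p : M} {w d d' σ err : ℝ} (hS : 1 < S.card) (hcur : s.cur ∈ S)
    (hgat : ∀ i ∈ S, s.pos i = p ∧ s.val i = w) (hσ : 0 ≤ σ) (herr : 0 ≤ err) :
    Progress T s S p w d' err σ ∨
      ∃ s' X b, TwoBranch T s S p w d σ s' X b 0 σ (-(d - 1) * σ) := by
  obtain ⟨x, hx, hx'⟩ := hM.exists_leaf s.pos p hσ
  obtain ⟨hp, hw⟩ := hgat _ hcur
  obtain ⟨v, hvS, hv⟩ := Finset.exists_mem_ne hS s.cur
  rcases hT.extend s hs x with h | ⟨u, hu, h⟩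
  · left
    set t := s.extend x s.cur (dist (s.pos s.cur) x) with ht
    have htcur : t.cur = s.cur := rfl
    have htx : t.pos s.cur = x := by simp [ht, ChaseState.extend]
    have hto : ∀ i, i ≠ s.cur → t.pos i = s.pos i ∧ t.val i = s.val i := by
      intro i hi
      simp [ht, ChaseState.extend, hi]
    have htc : t.cost = s.cost + σ := by simp [ht, ChaseState.extend, hp, hx]
    obtain ⟨r, hr, h1, h2, h3⟩ := hT.collapse hM hb x v {s.cur} t h (by simp [htcur])
      (by simpa using hv) (by simpa using htx)
    have hrS : ∀ i ∈ S, r.pos i = p ∧ r.val i = w := by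
      intro i hi
      by_cases hic : i = s.cur
      · rw [(h1 i (by simpa using hic)).1, (h1 i (by simpa using hic)).2, (hto v hv).1, (hto v hv).2]
        exact hgat v hvS
      · rw [(h2 i (by simpa using hic)).1, (h2 i (by simpa using hic)).2, (hto i hic).1,
          (hto i hic).2]
        exact hgat i hi
    have hro : ∀ i ∉ S, r.pos i = s.pos i ∧ r.val i = s.val i := by
      intro i hi
      have hic : i ≠ s.cur := fun hh => hi (hh ▸ hcur)
      rw [(h2 i (by simpa using hic)).1, (h2 i (by simpa using hic)).2]
      exact hto i hic
    -- The player followed the new leaf and paid `σ`, and that leaf is then discarded: progress with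
    -- `ω = 0`.
    refine ⟨r, hr, p, 0, le_rfl, herr, hro, by simpa using hrS, by simp, ?_⟩
    by_cases hrc : r.cur ∈ S
    · have : 0 ≤ dist x (r.pos r.cur) := dist_nonneg
      exact Or.inl ⟨hrc, by linarith, by linarith⟩
    · rw [(hro _ hrc).1, hx'] at h3
      exact Or.inr ⟨hrc, by linarith⟩
  · set t := s.extend x u (dist (s.pos s.cur) (s.pos u)) with ht
    have htcur : t.cur = u := rfl
    have htx : t.pos s.cur = x := by simp [ht, ChaseState.extend]
    have htv : t.val s.cur = w + σ := by simp [ht, ChaseState.extend, hp, hw, hx]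
    have hto : ∀ i, i ≠ s.cur → t.pos i = s.pos i ∧ t.val i = s.val i := by
      intro i hi
      simp [ht, ChaseState.extend, hi]
    have htc : t.cost = s.cost + dist p (s.pos u) := by simp [ht, ChaseState.extend, hp]
    have hne : ∀ i ∉ S, i ≠ s.cur := fun i hi hh => hi (hh ▸ hcur)
    by_cases huS : u ∈ S
    · right
      have hpu := (hgat u huS).1
      have htu : t.pos t.cur = p := by rw [htcur, (hto u hu).1, hpu]
      refine ⟨t, S.erase s.cur, s.cur, h, by simp [htcur, hu, huS], by simp,
        Finset.insert_erase hcur, ?_, htv, fun i hi => hto i (hne i hi), ?_, ?_, ?_, le_rfl, hσ,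
        by simp, ?_, ?_⟩
      · intro i hi
        simp only [Finset.mem_erase] at hi
        rw [htu, (hto i hi.1).1, (hto i hi.1).2, add_zero]
        exact hgat i hi.2
      · intro i _
        rw [htu, add_zero]
      · intro i _
        rw [htx, hx']
      · rw [htu, htx, hx, zero_add]
      · rw [htc, hpu, dist_self, add_zero]
      · rw [htc, hpu, dist_self]
        linarith
    · left
      obtain ⟨r, hr, r1, r2, r3, r4⟩ := hT.branch_finset {s.cur} v (by simpa using hv) t h
        (by simpa [htcur] using hu)
      refine ⟨r, hr, p, 0, le_rfl, herr, ?_, ?_, by simp, Or.inr ⟨by rwa [r1], ?_⟩⟩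
      · intro i hi
        rw [(r4 i (by simpa using hne i hi)).1, (r4 i (by simpa using hne i hi)).2]
        exact hto i (hne i hi)
      · intro i hi
        rw [add_zero]
        by_cases hic : i = s.cur
        · rw [(r3 i (by simpa using hic)).1, (r3 i (by simpa using hic)).2, (hto v hv).1,
            (hto v hv).2]
          exact hgat v hvS
        · rw [(r4 i (by simpa using hic)).1, (r4 i (by simpa using hic)).2, (hto i hic).1,
            (hto i hic).2]
          exact hgat i hi
      · rw [r1, r2, htc, htcur]
        linarith

theorem Forces.succ (hT : IsArena T) (hM : HasExtensions M) {ρ c₀ : ℝ}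
    (hb : ∀ s ∈ T, ∀ w, s.cost ≤ ρ * s.val w + c₀) {m : ℕ} (hm : 1 ≤ m) {D : ℝ} (hD : 1 ≤ D)
    (hF : Forces T m D) : Forces T (m + 1) (2 * D + Real.sqrt (8 + 8 * D) + 3) := by
  intro d' hd' err herr
  obtain ⟨D', θ, η, hd'D', hD', hθ, hθ1, hη, hq⟩ := exists_slack hD hd'
  obtain ⟨B, hB, hsearch⟩ := two_branch_search hD hD' hθ hθ1 hη hq
  have hB0 : 0 < B := by linarith
  set σ := err / B with hσ
  have hσ0 : 0 < σ := by positivity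
  have hBσ : B * σ = err := mul_div_cancel₀ _ hB0.ne'
  have hσerr : σ ≤ err := by nlinarith
  set d := D - θ with hd
  have hd0 : 0 < d := by linarith
  have hD'0 : 0 < D' := by linarith
  -- Chosen so that the loss `(d + 1) * e` per turn is the error term of `two_branch_search`.
  set e := θ * (σ / D') / (d + 1) with he
  have hde : (d + 1) * e = θ * (σ / D') := mul_div_cancel₀ _ (by linarith)
  have he0 : 0 < e := by positivity
  have heσ : e ≤ σ := by
    have h1 : σ / D' ≤ σ := div_le_self hσ0.le (by linarith)
    have h2 : θ * (σ / D') ≤ 1 * (σ / D') :=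
      mul_le_mul_of_nonneg_right (by linarith) (by positivity)
    nlinarith
  obtain ⟨η', hη', hsub⟩ := hF d (by linarith) e he0
  refine ⟨σ, hσ0, ?_⟩
  intro s hs S p w hS hcur hgat
  refine Progress.mono ?_ hd'D'
  rcases hT.split hM hb hs (d := d) (d' := D') (by omega) hcur hgat hσ0.le herr.le with
    h | ⟨s', X, b, h⟩
  · exact h
  refine hsearch σ err (fun α β Y => ∃ s' X b, TwoBranch T s S p w d σ s' X b α β Y) _ hσ0 hBσ.le
    ?_ ?_ ⟨s', X, b, h⟩
  · rintro α β Y ⟨t, X, b, h⟩ hβ hc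
    refine h.finish hT hM hb hβ ?_
    have := h.le_cost
    linarith
  · rintro α β Y ⟨t, X, b, h⟩ hβ ha
    rw [← hde] at ha ⊢
    rcases h.turn hT hM hb hd0.le hη' hsub hS heσ (heσ.trans hσerr) hβ ha with
      h | ⟨t', X', b', α', h1, h2, h3⟩
    · exact Or.inl h
    · exact Or.inr ⟨α', ⟨t', X', b', h1⟩, h2, h3⟩

theorem one_le_seqD (m : ℕ) : 1 ≤ seqD (m + 1) := by
  induction m with
  | zero => simp [seqD]
  | succ m ih =>
    rw [seqD]
    have := Real.sqrt_nonneg (8 + 8 * seqD (m + 1))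
    linarith

theorem forces_seqD (hT : IsArena T) (hM : HasExtensions M) {ρ c₀ : ℝ}
    (hb : ∀ s ∈ T, ∀ w, s.cost ≤ ρ * s.val w + c₀) (m : ℕ) : Forces T (m + 1) (seqD (m + 1)) := by
  induction m with
  | zero => simpa [seqD] using forces_one hT hM
  | succ m ih => exact Forces.succ hT hM hb (by omega) (one_le_seqD m) ih

/-- In an arena that contains a state with all leaves at one point, the online cost is not bounded
by less than `seqD k` times the offline cost. -/
theorem IsArena.exists_cost_gt (hT : IsArena T) (hM : HasExtensions M) (hk : 1 ≤ k)
    {s₀ : ChaseState k M} (hs₀ : s₀ ∈ T) {p : M} (hp : ∀ i, s₀.pos i = p ∧ s₀.val i = 0)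
    (hc : s₀.cost = 0) {ρ : ℝ} (hρ : 0 ≤ ρ) (hρk : ρ < seqD k) (c₀ : ℝ) :
    ∃ s ∈ T, ∃ w, ρ * s.val w + c₀ < s.cost := by
  by_contra! hb
  obtain ⟨m, rfl⟩ := Nat.exists_eq_add_of_le' hk
  obtain ⟨d, hd1, hd2⟩ := exists_between hρk
  obtain ⟨η, hη, hF⟩ := forces_seqD hT hM hb m d hd2 1 one_pos
  -- With `S` the set of all leaves the player cannot leave, so rounds of ratio `d > ρ` can be
  -- repeated until the additive constant is exceeded.
  have key : ∀ n : ℕ, ∃ s ∈ T, ∃ (q : M) (w : ℝ), (∀ i, s.pos i = q ∧ s.val i = w) ∧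
      d * w ≤ s.cost ∧ n * η ≤ s.cost := by
    intro n
    induction n with
    | zero => exact ⟨s₀, hs₀, p, 0, hp, by simp [hc], by simp [hc]⟩
    | succ n ih =>
      obtain ⟨s, hs, q, w, h1, h2, h3⟩ := ih
      obtain ⟨s', hs', q', ω, -, -, -, hin, -, hcase⟩ :=
        hF s hs Finset.univ q w (by simp) (by simp) (fun i _ => h1 i)
      rcases hcase with ⟨-, h4, h5⟩ | ⟨h4, -⟩
      · refine ⟨s', hs', q', w + ω, fun i => hin i (by simp), by linarith, ?_⟩
        push_cast
        linarith
      · simp at h4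
  have hd0 : 0 < d := by linarith
  obtain ⟨n, hn⟩ := exists_nat_gt (d * c₀ / (d - ρ) / η)
  obtain ⟨s, hs, q, w, h1, h2, h3⟩ := key n
  rw [div_lt_iff₀ hη, div_lt_iff₀ (by linarith)] at hn
  have h4 := hb s hs s.cur
  rw [(h1 s.cur).2] at h4
  have h5 : d * s.cost ≤ ρ * s.cost + d * c₀ := by
    have h6 := mul_le_mul_of_nonneg_left h4 hd0.le
    have h7 := mul_le_mul_of_nonneg_left h2 hρ
    nlinarith
  have h8 : n * η * (d - ρ) ≤ s.cost * (d - ρ) :=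
    mul_le_mul_of_nonneg_right h3 (by linarith)
  nlinarith

end Step

/-! ### A metric space with room in every direction -/

section Space

/-- Finitely supported real sequences, with the `ℓ¹` distance. -/
def FinSeq : Type := ℕ →₀ ℝ

/-- The `ℓ¹` distance of finitely supported sequences. -/
noncomputable def l1Dist (f g : ℕ →₀ ℝ) : ℝ := (f - g).sum fun _ x => |x|

theorem l1Dist_eq_sum {f g : ℕ →₀ ℝ} {U : Finset ℕ} (hf : f.support ⊆ U) (hg : g.support ⊆ U) :
    l1Dist f g = ∑ i ∈ U, |f i - g i| := by
  rw [l1Dist, Finsupp.sum_of_support_subset (s := U)]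
  · simp
  · exact (Finsupp.support_sub).trans (Finset.union_subset hf hg)
  · simp

theorem l1Dist_comm (f g : ℕ →₀ ℝ) : l1Dist f g = l1Dist g f := by
  rw [l1Dist_eq_sum Finset.subset_union_left Finset.subset_union_right,
    l1Dist_eq_sum (f := g) Finset.subset_union_right Finset.subset_union_left]
  exact Finset.sum_congr rfl fun i _ => abs_sub_comm _ _

theorem l1Dist_triangle (f g h : ℕ →₀ ℝ) : l1Dist f h ≤ l1Dist f g + l1Dist g h := by
  have hf : f.support ⊆ f.support ∪ (g.support ∪ h.support) := Finset.subset_union_left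
  have hg : g.support ⊆ f.support ∪ (g.support ∪ h.support) :=
    Finset.subset_union_left.trans Finset.subset_union_right
  have hh : h.support ⊆ f.support ∪ (g.support ∪ h.support) :=
    Finset.subset_union_right.trans Finset.subset_union_right
  rw [l1Dist_eq_sum hf hg, l1Dist_eq_sum hf hh, l1Dist_eq_sum hg hh, ← Finset.sum_add_distrib]
  exact Finset.sum_le_sum fun i _ => abs_sub_le _ _ _

theorem eq_of_l1Dist_eq_zero {f g : ℕ →₀ ℝ} (h : l1Dist f g = 0) : f = g := by
  rw [l1Dist_eq_sum Finset.subset_union_left Finset.subset_union_right,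
    Finset.sum_eq_zero_iff_of_nonneg fun i _ => abs_nonneg _] at h
  refine Finsupp.ext fun i => ?_
  by_cases hi : i ∈ f.support ∪ g.support
  · exact sub_eq_zero.1 (abs_eq_zero.1 (h i hi))
  · simp only [Finset.mem_union, Finsupp.mem_support_iff, not_or, not_not] at hi
    rw [hi.1, hi.2]

noncomputable instance : MetricSpace FinSeq where
  dist := l1Dist
  dist_self := fun f : ℕ →₀ ℝ => show l1Dist f f = 0 by simp [l1Dist]
  dist_comm := l1Dist_comm
  dist_triangle := l1Dist_triangle
  eq_of_dist_eq_zero := eq_of_l1Dist_eq_zero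

/-- A coordinate on which `p` and all points of `F` vanish is always available; moving along it adds
`t` to every distance. -/
theorem hasExtensions_finSeq : HasExtensions FinSeq := by
  classical
  intro F p t ht
  let sup : FinSeq → Finset ℕ := fun f => Finsupp.support f
  obtain ⟨n, hn⟩ := Infinite.exists_notMem_finset (F.biUnion sup ∪ sup p)
  simp only [Finset.mem_union, Finset.mem_biUnion, not_or, not_exists, not_and] at hn
  have hp : Finsupp.toFun p n = 0 := Finsupp.notMem_support_iff.1 hn.2
  let P : ℕ →₀ ℝ := p
  refine ⟨(P + Finsupp.single n t : ℕ →₀ ℝ), fun x hx => ?_⟩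
  let X : ℕ →₀ ℝ := x
  change l1Dist (P + Finsupp.single n t) X = l1Dist P X + t
  have hx : X n = 0 := Finsupp.notMem_support_iff.1 (hn.1 x hx)
  have hp : P n = 0 := hp
  have hsub : P + Finsupp.single n t - X = (P - X) + Finsupp.single n t := by abel
  rw [l1Dist, l1Dist, hsub, Finsupp.sum_add_index_of_disjoint]
  · rw [Finsupp.sum_single_index (by simp), abs_of_nonneg ht]
  · rw [Finset.disjoint_left]
    intro i hi hi'
    have : i = n := by simpa using Finsupp.support_single_subset hi'
    subst this
    simp [hx, hp] at hi

end Space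

/-! ### Realizing the game by taxi requests -/

section Taxi

variable {k : ℕ} {M : Type}

/-- The configuration at the end of a sequence of requests with the reactions to them. -/
def taxiEnd : (Fin k → M) → List (TaxiRequest M × TaxiMove k M) → Fin k → M
  | C, [] => C
  | _, (r, a) :: l => taxiEnd (a.result r) l

theorem taxiEnd_concat (C : Fin k → M) (l : List (TaxiRequest M × TaxiMove k M))
    (r : TaxiRequest M) (a : TaxiMove k M) : taxiEnd C (l ++ [(r, a)]) = a.result r := by
  induction l generalizing C with
  | nil => rfl
  | cons x l ih => exact ih _

theorem taxiRun_concat (act : List (TaxiRequest M) → TaxiRequest M → TaxiMove k M)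
    (past σ : List (TaxiRequest M)) (r : TaxiRequest M) :
    taxiRun act past (σ ++ [r]) = taxiRun act past σ ++ [(r, act (past ++ σ) r)] := by
  induction σ generalizing past with
  | nil => simp [taxiRun]
  | cons x σ ih => simp [taxiRun, ih]

variable [MetricSpace M]

theorem taxiScheduleCost_concat (C : Fin k → M) (l : List (TaxiRequest M × TaxiMove k M))
    (r : TaxiRequest M) (a : TaxiMove k M) :
    taxiScheduleCost C (l ++ [(r, a)]) = taxiScheduleCost C l + a.cost (taxiEnd C l) := by
  induction l generalizing C with
  | nil => simp [taxiScheduleCost, taxiEnd]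
  | cons x l ih => simp [taxiScheduleCost, taxiEnd, ih, add_assoc]

theorem taxiScheduleCost_nonneg (C : Fin k → M) (l : List (TaxiRequest M × TaxiMove k M)) :
    0 ≤ taxiScheduleCost C l := by
  induction l generalizing C with
  | nil => exact le_rfl
  | cons x l ih => exact add_nonneg (Finset.sum_nonneg fun _ _ => dist_nonneg) (ih _)

theorem taxiOpt_nonneg (C : Fin k → M) (σ : List (TaxiRequest M)) : 0 ≤ taxiOpt C σ :=
  Real.sInf_nonneg (by rintro x ⟨l, -, rfl⟩; exact taxiScheduleCost_nonneg C l)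

/-- A lazy player in configuration `X` could have served `σ` at cost `c` by following the
algorithm `A`: the algorithm has paid `c` and the distance to the configuration `X`. -/
def Tracks (A : OnlineTaxiAlgorithm k) (C₀ : Fin k → M) (σ : List (TaxiRequest M))
    (X : Fin k → M) (c : ℝ) : Prop :=
  ∃ π : Equiv.Perm (Fin k),
    c + ∑ i, dist (X i) (taxiEnd C₀ (taxiRun (A.act M C₀) [] σ) (π i)) ≤ A.cost C₀ σ

/-- `σ` can be served offline at cost at most `w` with final configuration `Y`, up to the order of
the taxis. -/
def Reaches (C₀ : Fin k → M) (σ : List (TaxiRequest M)) (Y : Fin k → M) (w : ℝ) : Prop :=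
  ∃ l : List (TaxiRequest M × TaxiMove k M), IsTaxiSchedule σ l ∧ taxiScheduleCost C₀ l ≤ w ∧
    ∃ π : Equiv.Perm (Fin k), ∀ i, taxiEnd C₀ l (π i) = Y i

theorem Reaches.opt_le {C₀ Y : Fin k → M} {σ : List (TaxiRequest M)} {w : ℝ}
    (h : Reaches C₀ σ Y w) : taxiOpt C₀ σ ≤ w := by
  obtain ⟨l, h1, h2, -⟩ := h
  refine le_trans (csInf_le (a := taxiScheduleCost C₀ l) ⟨0, ?_⟩ ⟨l, h1, rfl⟩) h2
  rintro x ⟨l, -, rfl⟩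
  exact taxiScheduleCost_nonneg C₀ l

theorem Reaches.perm {C₀ Y : Fin k → M} {σ : List (TaxiRequest M)} {w : ℝ}
    (h : Reaches C₀ σ Y w) (e : Equiv.Perm (Fin k)) : Reaches C₀ σ (Y ∘ e) w := by
  obtain ⟨l, h1, h2, π, h3⟩ := h
  exact ⟨l, h1, h2, e.trans π, fun i => h3 (e i)⟩

theorem Reaches.move {C₀ Y : Fin k → M} {σ : List (TaxiRequest M)} {w : ℝ}
    (h : Reaches C₀ σ Y w) (x t : M) (i : Fin k) :
    Reaches C₀ (σ ++ [⟨x, t⟩]) (Function.update Y i t) (w + dist (Y i) x) := by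
  obtain ⟨l, ⟨h1, h1'⟩, h2, π, h3⟩ := h
  let a : TaxiMove k M := ⟨Function.update (taxiEnd C₀ l) (π i) x, π i⟩
  refine ⟨l ++ [(⟨x, t⟩, a)], ⟨by simp [h1], ?_⟩, ?_, π, ?_⟩
  · intro q hq
    rcases List.mem_append.1 hq with hq | hq
    · exact h1' q hq
    · obtain rfl := List.mem_singleton.1 hq
      simp [TaxiMove.Serves, a]
  · rw [taxiScheduleCost_concat]
    refine add_le_add h2 (le_of_eq ?_)
    rw [TaxiMove.cost, Finset.sum_eq_single (π i)]
    · simp [a, h3]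
    · intro j _ hj
      simp [a, hj]
    · simp
  · intro j
    rw [taxiEnd_concat]
    by_cases hj : j = i
    · subst hj
      simp [TaxiMove.result, a]
    · simp [TaxiMove.result, a, hj, h3]

theorem Reaches.free {C₀ Y : Fin k → M} {σ : List (TaxiRequest M)} {w : ℝ}
    (h : Reaches C₀ σ Y w) {x : M} (t : M) {i : Fin k} (hi : Y i = x) :
    Reaches C₀ (σ ++ [⟨x, t⟩]) (Function.update Y i t) w := by
  simpa [hi] using h.move x t i

/-- The algorithm's next reaction, seen from the configuration `X`. -/
theorem Tracks.next {A : OnlineTaxiAlgorithm k} {C₀ X : Fin k → M} {σ : List (TaxiRequest M)}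
    {c : ℝ} (h : Tracks A C₀ σ X c) (r : TaxiRequest M) :
    ∃ (Z : Fin k → M) (j : Fin k) (π : Equiv.Perm (Fin k)), Z j = r.start ∧
      (∀ i, taxiEnd C₀ (taxiRun (A.act M C₀) [] (σ ++ [r])) (π i) =
        Function.update Z j r.dest i) ∧
      c + ∑ i, dist (X i) (Z i) ≤ A.cost C₀ (σ ++ [r]) := by
  obtain ⟨π, hπ⟩ := h
  set a := A.act M C₀ σ r with ha
  refine ⟨fun i => a.pos (π i), π.symm a.taxi, π, ?_, ?_, ?_⟩
  · have h := A.serves M C₀ σ r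
    rw [TaxiMove.Serves, ← ha] at h
    simpa using h
  · intro i
    rw [taxiRun_concat, taxiEnd_concat, List.nil_append, ← ha, TaxiMove.result]
    by_cases hi : i = π.symm a.taxi
    · subst hi
      simp
    · have : π i ≠ a.taxi := fun hh => hi (by rw [← hh]; simp)
      simp [hi, this]
  · have hcost : A.cost C₀ (σ ++ [r]) = A.cost C₀ σ +
        ∑ i, dist (taxiEnd C₀ (taxiRun (A.act M C₀) [] σ) (π i)) (a.pos (π i)) := by
      rw [OnlineTaxiAlgorithm.cost, taxiRun_concat, taxiScheduleCost_concat, List.nil_append, ← ha,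
        TaxiMove.cost, OnlineTaxiAlgorithm.cost]
      congr 1
      exact (Equiv.sum_comp π fun i =>
        dist (taxiEnd C₀ (taxiRun (A.act M C₀) [] σ) i) (a.pos i)).symm
    have htri : ∑ i, dist (X i) (a.pos (π i)) ≤
        ∑ i, dist (X i) (taxiEnd C₀ (taxiRun (A.act M C₀) [] σ) (π i)) +
        ∑ i, dist (taxiEnd C₀ (taxiRun (A.act M C₀) [] σ) (π i)) (a.pos (π i)) := by
      rw [← Finset.sum_add_distrib]
      exact Finset.sum_le_sum fun i _ => dist_triangle _ _ _
    linarith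

theorem Tracks.move {A : OnlineTaxiAlgorithm k} {C₀ X : Fin k → M} {σ : List (TaxiRequest M)}
    {c : ℝ} (h : Tracks A C₀ σ X c) (x t : M) :
    ∃ i, Tracks A C₀ (σ ++ [⟨x, t⟩]) (Function.update X i t) (c + dist (X i) x) := by
  obtain ⟨Z, j, π, h1, h2, h3⟩ := h.next ⟨x, t⟩
  refine ⟨j, π, le_trans (le_of_eq ?_) h3⟩
  rw [add_assoc]
  congr 1
  simp only [h2]
  rw [← Finset.add_sum_erase _ _ (Finset.mem_univ j),
    ← Finset.add_sum_erase _ (fun i => dist (X i) (Z i)) (Finset.mem_univ j), h1]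
  simp only [Function.update_self, dist_self, zero_add]
  congr 1
  refine Finset.sum_congr rfl fun i hi => ?_
  simp [Finset.ne_of_mem_erase hi]

theorem Tracks.free {A : OnlineTaxiAlgorithm k} {C₀ X : Fin k → M} {σ : List (TaxiRequest M)}
    {c : ℝ} (h : Tracks A C₀ σ X c) {x : M} (t : M) {i : Fin k} (hi : X i = x) :
    Tracks A C₀ (σ ++ [⟨x, t⟩]) (Function.update X i t) c := by
  obtain ⟨Z, j, π, h1, h2, h3⟩ := h.next ⟨x, t⟩
  simp only at h1 h2
  -- If the algorithm serves with the taxi matched to `j`, exchanging partners is no loss: `dist (X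
  -- j) (Z i)` is at most the sum of the two old terms, by the triangle inequality through `x = X i
  -- = Z j`.
  refine ⟨(Equiv.swap i j).trans π, le_trans ?_ h3⟩
  simp only [Equiv.trans_apply, h2]
  refine add_le_add le_rfl ?_
  by_cases hij : i = j
  · subst hij
    refine Finset.sum_le_sum fun l _ => ?_
    rw [Equiv.swap_self, Equiv.refl_apply]
    by_cases hl : l = i
    · subst hl
      simp
    · simp [hl]
  · have hji : j ∈ Finset.univ.erase i := by simp [Ne.symm hij]
    rw [← Finset.add_sum_erase _ _ (Finset.mem_univ i), ← Finset.add_sum_erase _ _ hji,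
      ← Finset.add_sum_erase _ (fun i => dist (X i) (Z i)) (Finset.mem_univ i),
      ← Finset.add_sum_erase _ (fun i => dist (X i) (Z i)) hji]
    have hrest : ∀ l ∈ (Finset.univ.erase i).erase j,
        dist (Function.update X i t l) (Function.update Z j t (Equiv.swap i j l)) =
          dist (X l) (Z l) := by
      intro l hl
      have h1 : l ≠ j := Finset.ne_of_mem_erase hl
      have h2 : l ≠ i := Finset.ne_of_mem_erase (Finset.mem_of_mem_erase hl)
      simp [Equiv.swap_apply_of_ne_of_ne h2 h1, h1, h2]
    rw [Finset.sum_congr rfl hrest]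
    have htri := dist_triangle (X j) x (Z i)
    simp only [Function.update_self, Equiv.swap_apply_left, Equiv.swap_apply_right, dist_self,
      zero_add, Function.update_of_ne (Ne.symm hij), Function.update_of_ne hij, hi, h1]
    linarith

/-- The states of the chasing game that request sequences can bring about. -/
def realizable (A : OnlineTaxiAlgorithm k) (C₀ : Fin k → M) : Set (ChaseState k M) :=
  {s | ∃ σ : List (TaxiRequest M), Tracks A C₀ σ s.pos s.cost ∧
    ∀ w, Reaches C₀ σ (Function.update s.pos w (s.pos s.cur)) (s.val w)}

/-- Extending is the request from `L h` to `x`, made twice: the second forces an empty run, from `x`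
by the same taxi or from another leaf `u`. In the latter case a free ride from `x` to `L u` refills
leaf `u`. Offline, a player with `w ≠ h` has two taxis at `L h`, while `w = h` pays `dist (L h) x`.
-/
theorem isArena_realizable (A : OnlineTaxiAlgorithm k) (C₀ : Fin k → M) :
    IsArena (realizable A C₀) := by
  constructor
  · rintro ⟨L, h, W, c⟩ ⟨σ, hT, hR⟩ x
    simp only at hT hR
    have hT1 := hT.free x (i := h) rfl
    obtain ⟨u, hT2⟩ := hT1.move (L h) x
    have hR2 : ∀ w, Reaches C₀ (σ ++ [⟨L h, x⟩] ++ [⟨L h, x⟩])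
        (Function.update (Function.update L h x) w x)
        (Function.update W h (W h + dist (L h) x) w) := by
      intro w
      have hR0 := hR w
      by_cases hw : w = h
      · subst hw
        have h2 := (hR0.free (x := L w) x (i := w) (by simp)).move (L w) x w
        simpa [dist_comm] using h2
      · have h2 := (hR0.free (x := L h) x (i := h) (by simp [Ne.symm hw])).free (x := L h) x (i := w)
          (by simp [hw])
        rw [Function.update_of_ne hw]
        convert h2 using 1
        ext i
        by_cases hi : i = w
        · subst hi
          simp
        · by_cases hi' : i = h
          · subst hi'
            simp [hi]
          · simp [hi, hi']
    by_cases hu : u = h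
    · left
      subst hu
      refine ⟨σ ++ [⟨L u, x⟩] ++ [⟨L u, x⟩], ?_, ?_⟩
      · simpa [ChaseState.extend, dist_comm] using hT2
      · intro w
        simpa [ChaseState.extend] using hR2 w
    · right
      refine ⟨u, hu, σ ++ [⟨L h, x⟩] ++ [⟨L h, x⟩] ++ [⟨x, L u⟩], ?_, ?_⟩
      · have h3 := hT2.free (x := x) (L u) (i := u) (by simp)
        have e1 : Function.update (Function.update (Function.update L h x) u x) u (L u) =
            Function.update L h x := by
          ext i
          by_cases hi : i = u
          · subst hi
            simp [hu]
          · simp [hi]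
        rw [e1, Function.update_of_ne hu, dist_comm] at h3
        exact h3
      · intro w
        have h3 := (hR2 w).free (x := x) (L u) (i := w) (by simp)
        simpa [ChaseState.extend, hu] using h3
  · rintro ⟨L, h, W, c⟩ ⟨σ, hT, hR⟩ j w hj hw
    simp only at hT hR hj
    refine ⟨σ ++ [⟨L j, L w⟩], hT.free (L w) rfl, ?_⟩
    intro v
    simp only [ChaseState.branch, Function.update_of_ne (Ne.symm hj)]
    by_cases hv : v = j
    · subst hv
      -- The new offline player at leaf `v` is the one that was at `w`, with the names of these two
      -- taxis exchanged; hence it inherits the value of `w`.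
      have h1 := ((hR w).free (x := L v) (L w) (i := v) (by simp [Ne.symm hw])).perm
        (Equiv.swap v w)
      rw [Function.update_self]
      convert h1 using 1
      ext i
      by_cases hi : i = v
      · subst hi
        simp [hw]
      · by_cases hi' : i = w
        · subst hi'
          simp [hi]
        · simp [hi, hi', Equiv.swap_apply_of_ne_of_ne hi hi']
    · have h1 := (hR v).free (x := L j) (L w) (i := j) (by simp [Ne.symm hv])
      rw [Function.update_of_ne hv, Function.update_comm (Ne.symm hv)]
      exact h1

theorem OnlineTaxiAlgorithm.IsCompetitive.mono {A : OnlineTaxiAlgorithm k} {ρ ρ' : ℝ}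
    (h : A.IsCompetitive ρ) (hρ : ρ ≤ ρ') : A.IsCompetitive ρ' := by
  intro M _ C₀
  obtain ⟨c, hc⟩ := h M C₀
  exact ⟨c, fun σ => (hc σ).trans
    (add_le_add (mul_le_mul_of_nonneg_right hρ (taxiOpt_nonneg C₀ σ)) le_rfl)⟩

theorem OnlineTaxiAlgorithm.IsCompetitive.seqD_le {A : OnlineTaxiAlgorithm k} (hk : 1 ≤ k) {ρ : ℝ}
    (h : A.IsCompetitive ρ) : seqD k ≤ ρ := by
  by_contra! hlt
  have hD : 1 ≤ seqD k := by
    obtain ⟨m, rfl⟩ := Nat.exists_eq_add_of_le' hk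
    exact one_le_seqD m
  -- Replacing `ρ` by `max ρ 0` allows upper bounds on the optimum to be multiplied by it.
  have hmax : max ρ 0 < seqD k := max_lt hlt (by linarith)
  let O : FinSeq := (0 : ℕ →₀ ℝ)
  obtain ⟨c₀, hc₀⟩ := h.mono (le_max_left ρ 0) FinSeq (fun _ => O)
  let s₀ : ChaseState k FinSeq := ⟨fun _ => O, ⟨0, hk⟩, fun _ => 0, 0⟩
  have hs₀ : s₀ ∈ realizable A fun _ => O := by
    refine ⟨[], ⟨1, ?_⟩, fun w => ⟨[], ⟨rfl, by simp⟩, le_rfl, 1, fun i => ?_⟩⟩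
    · simp [s₀, taxiEnd, taxiRun, OnlineTaxiAlgorithm.cost, taxiScheduleCost]
    · simp [s₀, taxiEnd]
  obtain ⟨s, ⟨σ, ⟨π, hT⟩, hR⟩, w, hs⟩ := (isArena_realizable A fun _ => O).exists_cost_gt
    hasExtensions_finSeq hk hs₀ (p := O) (fun _ => ⟨rfl, rfl⟩) rfl (le_max_right ρ 0) hmax c₀
  have h1 := hc₀ σ
  have h2 := mul_le_mul_of_nonneg_left (hR w).opt_le (le_max_right ρ 0)
  have h3 : 0 ≤ ∑ i, dist (s.pos i)
      (taxiEnd (fun _ => O) (taxiRun (A.act FinSeq fun _ => O) [] σ) (π i)) :=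
    Finset.sum_nonneg fun _ _ => dist_nonneg
  linarith

end Taxi

theorem corollary6 (k : ℕ) (hk : 1 ≤ k) (A : OnlineTaxiAlgorithm k) :
    (seqD k : EReal) ≤ A.competitiveRatio := by
  refine le_sInf ?_
  rintro _ ⟨ρ, hρ, rfl⟩
  exact EReal.coe_le_coe_iff.2 (OnlineTaxiAlgorithm.IsCompetitive.seqD_le hk hρ)
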